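/- Let $q\ge 5$ be a prime power and let $\mathcal{C}$ be the $[q+1,q-3,5]_q$ generalized doubly-extended Reed-Solomon code of covering radius $3$ associated with the twisted cubic, i.e. the linear code over $\mathbb{F}_q$ with a $4\times(q+1)$ parity check matrix whose columns are, in some order and up to nonzero scalar factors, the vectors $(1,t,t^2,t^3)^{tr}$, $t\in\mathbb{F}_q$, and $(0,0,0,1)^{tr}$. Let $A_w$ be the number of codewords of $\mathcal{C}$ of Hamming weight $w$. Let $\mathcal{V}$ be a coset of $\mathcal{C}$ of weight $2$, i.e. the smallest Hamming weight of a vector of $\mathcal{V}$ is $2$, and let $B_w$ be the number of vectors of Hamming weight $w$ in $\mathcal{V}$. Then $B_0=B_1=0$, $B_2=1$, and $$B_3=\frac13\binom{q-2}{2}\ \text{ if } q\not\equiv1\pmod 3,\qquad B_3\in\left\{\frac{q^2-5q+4}{6},\ \frac{q^2-5q+10}{6}\right\}\ \text{ if } q\equiv1\pmod3,$$ $$B_4=\binom{q+1}{4}-\binom{q-1}{2}-(q-2)B_3,$$ and, for all $w\ge5$, $$B_w=A_w+(-1)^w\left[\binom{q+1}{w}\binom{w-1}{3}-(w-3)\binom{q-1}{w-2}-\binom{q-2}{w-3}B_3\right].$$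 -/

import Mathlib

namespace TwistedCubicCode

variable {F : Type*} [Field F]

/-- Homogeneous coordinates of the point `P(t)` of the twisted cubic in `PG(3,q)`, for
`t ∈ F ∪ {∞}`: `P(t) = (1, t, t², t³)` for `t ∈ F` and `P(∞) = (0, 0, 0, 1)`. -/
def cubicPoint (t : OnePoint F) : Fin 4 → F :=
  t.elim ![0, 0, 0, 1] (fun a : F => ![1, a, a ^ 2, a ^ 3])

/-- The `4 × n` matrix whose `j`-th column is the point `P(e j)` of the twisted cubic, in the
homogeneous coordinates scaled by the nonzero factor `v j`. -/
def parityCheck {n : ℕ} (e : Fin n ≃ OnePoint F) (v : Fin n → Fˣ) : Matrix (Fin 4) (Fin n) F :=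
  Matrix.of fun i j => (v j : F) * cubicPoint (e j) i

/-- The linear code of length `n` with parity check matrix `parityCheck e v`. When `F` has `q`
elements and `n = q + 1`, it is the generalized doubly-extended Reed-Solomon code associated with
the twisted cubic; `e` is the ordering of the points, `v` the choice of homogeneous coordinates. -/
def code {n : ℕ} (e : Fin n ≃ OnePoint F) (v : Fin n → Fˣ) : Submodule F (Fin n → F) :=
  LinearMap.ker (parityCheck e v).mulVecLin

/-- `V` is a coset of the linear code `C`. -/
def IsCoset {n : ℕ} (C : Submodule F (Fin n → F)) (V : Set (Fin n → F)) : Prop :=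
  ∃ v : Fin n → F, V = {x | ∃ c ∈ C, x = c + v}

/-- The number of vectors of Hamming weight `w` in the set `V`. -/
noncomputable def weightCount [DecidableEq F] {n : ℕ} (V : Set (Fin n → F)) (w : ℕ) : ℕ :=
  {x ∈ V | hammingNorm x = w}.ncard

/-- `V` has weight `W`: the smallest Hamming weight of a vector of `V` is `W`. -/
def HasWeight [DecidableEq F] {n : ℕ} (V : Set (Fin n → F)) (W : ℕ) : Prop :=
  IsLeast {w | ∃ x ∈ V, hammingNorm x = w} W

end TwistedCubicCode

/-! Any four columns of the parity check matrix are independent, so on each set of at least four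
positions all syndromes are attained equally often (`ncard_supported_eq`). Hence the differences `D
w = B w - A w` have vanishing binomial moments of order at least 4. These moments form a triangular
system, so `D` is determined by `D 0 = -1`, `D 1 = 0`, `D 2 = 1`, `D 3 = B 3`, and its solutions are
`(-1) ^ w * n.choose w` times a polynomial in `w` of degree at most 3 (`weight_difference_eq`).

For `B 3`, let the weight-two vector be supported at `i`, `j`. A coordinate on the projective line
sending these points to `0` and `∞` identifies the other points with `Fˣ`; the plane through `x`,
`y`, `z` contains the syndrome iff `x * y * z = c` (`exists_weightCount_three_eq`). Counting such
triples leaves only the number of cube roots of `c` in a cyclic group of order `q - 1`: it is 1 if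
`q ≢ 1` mod 3, and 0 or 3 otherwise. -/

namespace TwistedCubicCode

open Finset

/-! ### Three-element subsets of a finite abelian group with given product. -/

section TripleCount

variable {G : Type*} [CommGroup G] [Fintype G] [DecidableEq G]

/-- Ordered pairs `(x, y)` such that `x`, `y` and `c / (x y)` are distinct. -/
def distinctPairs (c : G) : Finset (G × G) :=
  univ.filter fun p => p.1 ≠ p.2 ∧ p.1 ≠ c / (p.1 * p.2) ∧ p.2 ≠ c / (p.1 * p.2)

/-- Inclusion-exclusion over the coincidences among `x`, `y`, `c / (x y)`. -/
theorem card_distinctPairs (c : G) :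
    ((distinctPairs c).card : ℤ) =
      (Fintype.card G : ℤ) ^ 2 - 3 * Fintype.card G
        + 2 * (univ.filter fun x : G => x ^ 3 = c).card := by
  -- Any two of the coincidences force the third, with `x ^ 3 = c`; that case is subtracted three
  -- times, so 2 is added back.
  have pointwise : ∀ p : G × G,
      (if p.1 ≠ p.2 ∧ p.1 ≠ c / (p.1 * p.2) ∧ p.2 ≠ c / (p.1 * p.2) then (1 : ℤ) else 0) =
        1 - (if p.1 = p.2 then 1 else 0) - (if p.2 = c / (p.1 * p.1) then 1 else 0)
          - (if p.1 = c / (p.2 * p.2) then 1 else 0)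
          + 2 * (if p.2 = p.1 then (if p.1 ^ 3 = c then 1 else 0) else 0) := by
    rintro ⟨x, y⟩
    have h1 : x = c / (x * y) ↔ y = c / (x * x) := by
      rw [eq_div_iff_mul_eq', eq_div_iff_mul_eq']
      constructor <;> rintro rfl <;> simp [mul_comm, mul_left_comm]
    have h2 : y = c / (x * y) ↔ x = c / (y * y) := by
      rw [eq_div_iff_mul_eq', eq_div_iff_mul_eq']
      constructor <;> rintro rfl <;> simp [mul_left_comm]
    have h3 : x = c / (x * x) ↔ x ^ 3 = c := by
      rw [eq_div_iff_mul_eq', pow_succ', pow_two]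
    simp only [ne_eq, h1, h2]
    by_cases hxy : x = y
    · subst hxy
      by_cases hx : x ^ 3 = c <;> simp [h3, hx]
    · have hyx : ¬ y = x := fun h => hxy h.symm
      by_cases ha : y = c / (x * x)
      · have hb : ¬ x = c / (y * y) := by
          intro hb
          rw [← h1] at ha
          rw [← h2] at hb
          exact hxy (ha.trans hb.symm)
        simp [hxy, hyx, ← ha, hb]
      · by_cases hb : x = c / (y * y)
        · simp [hxy, hyx, ha, ← hb]
        · simp [hxy, hyx, ha, hb]
  have h : ((distinctPairs c).card : ℤ) = ∑ p : G × G,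
      (if p.1 ≠ p.2 ∧ p.1 ≠ c / (p.1 * p.2) ∧ p.2 ≠ c / (p.1 * p.2) then (1 : ℤ) else 0) := by
    rw [distinctPairs, card_filter]
    push_cast
    rfl
  rw [h, sum_congr rfl fun p _ => pointwise p]
  simp only [sum_add_distrib, sum_sub_distrib, ← mul_sum]
  have e1 : ∑ p : G × G, (if p.1 = p.2 then (1 : ℤ) else 0) = Fintype.card G := by
    rw [Fintype.sum_prod_type]; simp
  have e2 : ∑ p : G × G, (if p.2 = c / (p.1 * p.1) then (1 : ℤ) else 0) = Fintype.card G := by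
    rw [Fintype.sum_prod_type]; simp
  have e3 : ∑ p : G × G, (if p.1 = c / (p.2 * p.2) then (1 : ℤ) else 0) = Fintype.card G := by
    rw [Fintype.sum_prod_type_right]; simp
  have e4 : ∑ p : G × G, (if p.2 = p.1 then (if p.1 ^ 3 = c then (1 : ℤ) else 0) else 0) =
      (univ.filter fun x : G => x ^ 3 = c).card := by
    rw [Fintype.sum_prod_type]; simp
  rw [e1, e2, e3, e4]
  simp
  ring

/-- Each three-element set with product `c` comes from six ordered pairs. -/
theorem card_distinctPairs_eq_six_mul (c : G) :
    (distinctPairs c).card =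
      6 * ((univ.powersetCard 3).filter fun T : Finset G => ∏ x ∈ T, x = c).card := by
  have hmaps : ∀ p ∈ distinctPairs c, ({p.1, p.2, c / (p.1 * p.2)} : Finset G) ∈
      (univ.powersetCard 3).filter fun T : Finset G => ∏ x ∈ T, x = c := by
    intro p hp
    obtain ⟨h1, h2, h3⟩ := (mem_filter.1 hp).2
    rw [mem_filter, mem_powersetCard_univ]
    refine ⟨card_eq_three.2 ⟨_, _, _, h1, h2, h3, rfl⟩, ?_⟩
    rw [prod_insert (by simp [h1, h2]), prod_insert (by simp [h3]), prod_singleton]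
    simp [← mul_assoc]
  rw [card_eq_sum_card_fiberwise hmaps, mul_comm]
  refine sum_const_nat fun T hT => ?_
  rw [mem_filter, mem_powersetCard_univ] at hT
  obtain ⟨⟨x, y, z, hxy, hxz, hyz, rfl⟩, hprod⟩ := And.imp_left card_eq_three.1 hT
  rw [prod_insert (by simp [hxy, hxz]), prod_insert (by simp [hyz]), prod_singleton] at hprod
  have hfib : ((distinctPairs c).filter fun p => ({p.1, p.2, c / (p.1 * p.2)} : Finset G) =
      {x, y, z}) = {(x, y), (x, z), (y, x), (y, z), (z, x), (z, y)} := by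
    have hx : c / (y * z) = x := by rw [div_eq_iff_eq_mul, ← hprod]
    have hy : c / (x * z) = y := by rw [div_eq_iff_eq_mul, ← hprod, mul_left_comm]
    have hz : c / (x * y) = z := by
      rw [div_eq_iff_eq_mul, ← hprod, mul_comm z, mul_assoc]
    ext ⟨a, b⟩
    simp only [distinctPairs, mem_filter, mem_univ, true_and, mem_insert, mem_singleton,
      Prod.mk.injEq]
    constructor
    · rintro ⟨⟨hab, -, -⟩, hset⟩
      have ha : a ∈ ({x, y, z} : Finset G) := hset ▸ by simp
      have hb : b ∈ ({x, y, z} : Finset G) := hset ▸ by simp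
      simp only [mem_insert, mem_singleton] at ha hb
      rcases ha with rfl | rfl | rfl <;> rcases hb with rfl | rfl | rfl <;> simp_all
    · rintro (⟨rfl, rfl⟩ | ⟨rfl, rfl⟩ | ⟨rfl, rfl⟩ | ⟨rfl, rfl⟩ | ⟨rfl, rfl⟩ | ⟨rfl, rfl⟩)
      · rw [hz]; exact ⟨⟨hxy, hxz, hyz⟩, rfl⟩
      · rw [hy]; exact ⟨⟨hxz, hxy, hyz.symm⟩, by grind⟩
      · rw [mul_comm, hz]; exact ⟨⟨hxy.symm, hyz, hxz⟩, by grind⟩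
      · rw [hx]; exact ⟨⟨hyz, hxy.symm, hxz.symm⟩, by grind⟩
      · rw [mul_comm, hy]; exact ⟨⟨hxz.symm, hyz.symm, hxy⟩, by grind⟩
      · rw [mul_comm, hx]; exact ⟨⟨hyz.symm, hxz.symm, hxy.symm⟩, by grind⟩
  rw [hfib]
  have := hxy.symm; have := hxz.symm; have := hyz.symm
  repeat rw [card_insert_of_notMem (by simp [*])]
  simp

theorem six_mul_card_triples_prod_eq (c : G) :
    6 * (((univ.powersetCard 3).filter fun T : Finset G => ∏ x ∈ T, x = c).card : ℤ) =
      (Fintype.card G : ℤ) ^ 2 - 3 * Fintype.card G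
        + 2 * (univ.filter fun x : G => x ^ 3 = c).card := by
  rw [← card_distinctPairs, card_distinctPairs_eq_six_mul]
  push_cast
  rfl

/-- In a finite cyclic group the number of cube roots is `0` or `gcd (|G|, 3)`. -/
theorem card_cube_roots [IsCyclic G] (c : G) :
    (univ.filter fun x : G => x ^ 3 = c).card = 0 ∨
      (univ.filter fun x : G => x ^ 3 = c).card = (Fintype.card G).gcd 3 := by
  rcases (univ.filter fun x : G => x ^ 3 = c).eq_empty_or_nonempty with h | ⟨x₀, hx₀⟩
  · exact Or.inl (by rw [h, card_empty])
  · right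
    replace hx₀ := (mem_filter.1 hx₀).2
    -- The cube roots of `c` form the coset by `x₀` of the kernel of cubing.
    rw [← Nat.card_eq_fintype_card, ← IsCyclic.card_powMonoidHom_ker, ← Nat.card_eq_finsetCard]
    refine Nat.card_congr ⟨fun x => ⟨x / x₀, ?_⟩, fun y => ⟨y * x₀, ?_⟩, fun x => ?_, fun y => ?_⟩
    · simp [MonoidHom.mem_ker, div_pow, hx₀, (mem_filter.1 x.2).2]
    · have := y.2
      rw [MonoidHom.mem_ker, powMonoidHom_apply] at this
      simp [mul_pow, hx₀, this]
    · simp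
    · simp

theorem card_cube_roots_of_coprime (h : (Nat.card G).Coprime 3) (c : G) :
    (univ.filter fun x : G => x ^ 3 = c).card = 1 := by
  rw [card_eq_one]
  refine ⟨(powCoprime h).symm c, ?_⟩
  ext x
  rw [mem_singleton, Equiv.eq_symm_apply, powCoprime_apply, mem_filter]
  simp

end TripleCount

/-! ### Binomial moments and the sequences they determine. -/

section WeightEnumerator

/-- Summing over all `j`-sets the number of vectors of `V` supported in the set. -/
theorem sum_weightCount_mul_choose {F : Type*} [Field F] [Fintype F] [DecidableEq F] {n : ℕ}
    (V : Set (Fin n → F)) (j : ℕ) :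
    ∑ i ∈ range (j + 1), weightCount V i * (n - i).choose (j - i) =
      ∑ T ∈ (univ : Finset (Fin n)).powersetCard j, {x ∈ V | ∀ k ∉ T, x k = 0}.ncard := by
  classical
  have hsupp : ∀ (x : Fin n → F) (T : Finset (Fin n)),
      (∀ k ∉ T, x k = 0) ↔ (univ.filter fun k => x k ≠ 0) ⊆ T := by
    intro x T
    simp only [subset_iff, mem_filter, mem_univ, true_and]
    exact forall_congr' fun k => not_imp_comm
  have hN : ∀ T : Finset (Fin n), {x ∈ V | ∀ k ∉ T, x k = 0}.ncard =
      ∑ x ∈ univ.filter (· ∈ V), if (univ.filter fun k => x k ≠ 0) ⊆ T then 1 else 0 := by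
    intro T
    rw [← card_filter, filter_filter, ← Set.ncard_coe_finset]
    congr 1
    ext x
    simp [hsupp]
  have hW : ∀ i, weightCount V i =
      ∑ x ∈ univ.filter (· ∈ V), if hammingNorm x = i then 1 else 0 := by
    intro i
    rw [← card_filter, filter_filter, weightCount, ← Set.ncard_coe_finset]
    congr 1
    ext x
    simp
  simp only [hN, hW, sum_mul]
  rw [sum_comm, sum_comm (s := powersetCard j univ)]
  refine sum_congr rfl fun x _ => ?_
  rw [← card_filter]
  have hcard : (univ.filter fun k => x k ≠ 0).card = hammingNorm x := rfl
  -- Double counting: a support of size `i ≤ j` lies in `(n - i).choose (j - i)` sets of size `j`.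
  by_cases hx : hammingNorm x ≤ j
  · rw [card_filter_powersetCard_subset _ _ _ (subset_univ _) (by rw [hcard]; exact hx), hcard]
    rw [sum_eq_single_of_mem (hammingNorm x) (by simpa [Nat.lt_succ_iff] using hx)]
    · simp
    · intro b _ hb
      simp [hb.symm]
  · rw [sum_eq_zero, eq_comm, card_eq_zero, filter_eq_empty_iff]
    · intro T hT hsub
      have := card_le_card hsub
      rw [mem_powersetCard_univ] at hT
      omega
    · intro b hb
      have : hammingNorm x ≠ b := by
        rintro rfl
        exact hx (by simpa [Nat.lt_succ_iff] using hb)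
      simp [this]

/-- Up to sign this is the `j`-th finite difference of `P` at 0. -/
theorem sum_alternating_choose_mul_eval_eq_zero {P : Polynomial ℚ} {j : ℕ} (hP : P.natDegree < j) :
    ∑ i ∈ range (j + 1), (-1 : ℚ) ^ i * j.choose i * P.eval (i : ℚ) = 0 := by
  have h := congrFun (Polynomial.fwdDiff_iter_eq_zero_of_degree_lt hP) 0
  rw [fwdDiff_iter_eq_sum_shift] at h
  have h2 := congrArg (fun t : ℚ => (-1) ^ j * t) h
  simp only [mul_sum, Pi.zero_apply, mul_zero, zero_add, nsmul_eq_mul, mul_one] at h2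
  rw [← h2]
  refine sum_congr rfl fun i hi => ?_
  have hij : i ≤ j := by simpa [Nat.lt_succ_iff] using hi
  obtain ⟨k, rfl⟩ := Nat.exists_eq_add_of_le hij
  simp only [zsmul_eq_mul, add_tsub_cancel_left]
  push_cast
  have hk : (-1 : ℚ) ^ k * (-1) ^ k = 1 := by rw [← mul_pow]; norm_num
  rw [pow_add]
  linear_combination -((-1 : ℚ) ^ i * (i + k).choose i * P.eval (i : ℚ)) * hk

/-- A sequence with vanishing binomial moments of order `≥ m` which agrees below `m` with
`(-1) ^ w * (n.choose w) * P w`, `P` a polynomial of degree less than `m`, agrees everywhere. -/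
theorem eq_of_binomial_moments_eq_zero {n m : ℕ} {D : ℕ → ℚ} {P : Polynomial ℚ}
    (hP : P.natDegree < m)
    (hD : ∀ j, m ≤ j → ∑ i ∈ range (j + 1), D i * ((n - i).choose (j - i) : ℚ) = 0)
    (hlow : ∀ w < m, D w = (-1) ^ w * n.choose w * P.eval (w : ℚ)) (w : ℕ) :
    D w = (-1) ^ w * n.choose w * P.eval (w : ℚ) := by
  induction w using Nat.strong_induction_on with
  | _ w ih =>
    rcases lt_or_ge w m with hw | hw
    · exact hlow w hw
    -- `D w` has coefficient 1 in the moment of order `w`, so earlier values determine it.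
    · have h1 := hD w hw
      have h2 : ∑ i ∈ range (w + 1), ((-1) ^ i * n.choose i * P.eval (i : ℚ)) *
          ((n - i).choose (w - i) : ℚ) = 0 := by
        have h3 := sum_alternating_choose_mul_eval_eq_zero (lt_of_lt_of_le hP hw)
        calc _ = ∑ i ∈ range (w + 1),
              (n.choose w : ℚ) * ((-1 : ℚ) ^ i * w.choose i * P.eval (i : ℚ)) := by
              refine sum_congr rfl fun i hi => ?_
              have hiw : i ≤ w := by simpa [Nat.lt_succ_iff] using hi
              have h4 : (n.choose w : ℚ) * w.choose i = n.choose i * (n - i).choose (w - i) := by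
                exact_mod_cast Nat.choose_mul hiw
              linear_combination -((-1 : ℚ) ^ i * P.eval (i : ℚ)) * h4
          _ = 0 := by rw [← mul_sum, h3, mul_zero]
      rw [sum_range_succ] at h1 h2
      rw [sum_congr rfl fun i hi => by rw [ih i (mem_range.1 hi)]] at h1
      simp only [Nat.sub_self, Nat.choose_zero_right, Nat.cast_one, mul_one] at h1 h2
      linarith

/-- Used to rewrite a shifted binomial as `n.choose w` times a polynomial in `w`. -/
theorem cast_choose_sub_two {n w : ℕ} (hn : 2 ≤ n) (hw : 2 ≤ w) :
    (n : ℚ) * (n - 1) * (n - 2).choose (w - 2) = n.choose w * w * (w - 1) := by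
  obtain ⟨n, rfl⟩ := Nat.exists_eq_add_of_le' hn
  obtain ⟨w, rfl⟩ := Nat.exists_eq_add_of_le' hw
  have h1 : ((n + 1 + 1 : ℕ) : ℚ) * (n + 1).choose (w + 1) =
      (n + 1 + 1).choose (w + 1 + 1) * (w + 1 + 1 : ℕ) := by
    exact_mod_cast Nat.add_one_mul_choose_eq (n + 1) (w + 1)
  have h2 : ((n + 1 : ℕ) : ℚ) * n.choose w = (n + 1).choose (w + 1) * (w + 1 : ℕ) := by
    exact_mod_cast Nat.add_one_mul_choose_eq n w
  simp only [Nat.add_sub_cancel]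
  push_cast at h1 h2 ⊢
  linear_combination (n + 2 : ℚ) * h2 + (w + 1 : ℚ) * h1

theorem cast_choose_sub_three {n w : ℕ} (hn : 3 ≤ n) (hw : 3 ≤ w) :
    (n : ℚ) * (n - 1) * (n - 2) * (n - 3).choose (w - 3) =
      n.choose w * w * (w - 1) * (w - 2) := by
  have h1 := cast_choose_sub_two (n := n) (w := w) (by omega) (by omega)
  obtain ⟨n, rfl⟩ := Nat.exists_eq_add_of_le' hn
  obtain ⟨w, rfl⟩ := Nat.exists_eq_add_of_le' hw
  have h2 : ((n + 1 : ℕ) : ℚ) * n.choose w = (n + 1).choose (w + 1) * (w + 1 : ℕ) := by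
    exact_mod_cast Nat.add_one_mul_choose_eq n w
  simp only [Nat.add_sub_cancel, show n + 3 - 2 = n + 1 by omega, show w + 3 - 2 = w + 1 by omega]
    at h1 ⊢
  push_cast at h1 h2 ⊢
  linear_combination ((n + 3) * (n + 2) : ℚ) * h2 + (w + 1 : ℚ) * h1

/-- At `w = 0` truncated subtraction breaks this: the cubic is then -6, which supplies `D 0 = -1`.
-/
theorem six_mul_cast_choose_three {w : ℕ} (hw : 1 ≤ w) :
    (6 : ℚ) * (w - 1).choose 3 = (w - 1) * (w - 2) * (w - 3) := by
  rcases le_or_gt w 3 with h | h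
  · interval_cases w <;> norm_num [Nat.choose]
  · have := cast_choose_sub_three (n := w - 1) (w := 3) (by omega) le_rfl
    rw [Nat.cast_sub hw] at this
    simp only [Nat.sub_self, Nat.choose_zero_right] at this
    push_cast at this
    linear_combination -this

/-- Weight distribution difference `D` between a coset of weight two and an MDS code of
codimension `4` and length `n`. -/
theorem weight_difference_eq {n : ℕ} (hn : 3 ≤ n) {D : ℕ → ℚ} (h0 : D 0 = -1) (h1 : D 1 = 0)
    (h2 : D 2 = 1)
    (hD : ∀ j, 4 ≤ j → ∑ i ∈ range (j + 1), D i * ((n - i).choose (j - i) : ℚ) = 0)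
    {w : ℕ} (hw : 3 ≤ w) :
    D w = (-1) ^ w * (n.choose w * (w - 1).choose 3 - (w - 3) * (n - 2).choose (w - 2)
      - (n - 3).choose (w - 3) * D 3) := by
  have hn' : (3 : ℚ) ≤ n := by exact_mod_cast hn
  have n0 : (n : ℚ) ≠ 0 := by linarith
  have n1 : (n : ℚ) - 1 ≠ 0 := by linarith
  have n2 : (n : ℚ) - 2 ≠ 0 := by linarith
  -- Lagrange interpolation at 0, 1, 2, 3: the three terms match `D 0`, `D 2` and `D 3` in turn,
  -- each vanishing at the other nodes.
  let P : Polynomial ℚ :=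
    Polynomial.C (1 / 6 : ℚ) * (Polynomial.X - Polynomial.C 1) * (Polynomial.X - Polynomial.C 2) *
        (Polynomial.X - Polynomial.C 3)
      - Polynomial.C (1 / (n * (n - 1)) : ℚ) * (Polynomial.X - Polynomial.C 3) * Polynomial.X *
        (Polynomial.X - Polynomial.C 1)
      - Polynomial.C (D 3 / (n * (n - 1) * (n - 2)) : ℚ) * Polynomial.X *
        (Polynomial.X - Polynomial.C 1) * (Polynomial.X - Polynomial.C 2)
  have hdeg : P.natDegree < 4 := Nat.lt_succ_of_le (by unfold P; compute_degree)
  have heval : ∀ x : ℚ, P.eval x = 1 / 6 * (x - 1) * (x - 2) * (x - 3)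
      - 1 / (n * (n - 1)) * (x - 3) * x * (x - 1)
      - D 3 / (n * (n - 1) * (n - 2)) * x * (x - 1) * (x - 2) := by
    intro x
    simp [P]
  have key := eq_of_binomial_moments_eq_zero (n := n) hdeg hD (fun w hw => ?_) w
  · rw [key, heval, mul_assoc]
    have e1 := six_mul_cast_choose_three (w := w) (by omega)
    have e2 := cast_choose_sub_two (n := n) (w := w) (by omega) (by omega)
    have e3 := cast_choose_sub_three (n := n) (w := w) (by omega) (by omega)
    congr 1
    rw [show ((w - 1).choose 3 : ℚ) = (w - 1) * (w - 2) * (w - 3) / 6 by linarith,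
      show ((n - 2).choose (w - 2) : ℚ) = n.choose w * w * (w - 1) / (n * (n - 1)) by
        rw [eq_div_iff (mul_ne_zero n0 n1)]; linarith,
      show ((n - 3).choose (w - 3) : ℚ) =
          n.choose w * w * (w - 1) * (w - 2) / (n * (n - 1) * (n - 2)) by
        rw [eq_div_iff (mul_ne_zero (mul_ne_zero n0 n1) n2)]; linarith]
    ring
  · have c2 := cast_choose_sub_two (n := n) (w := 2) (by omega) le_rfl
    have c3 := cast_choose_sub_three (n := n) (w := 3) hn le_rfl
    simp only [Nat.sub_self, Nat.choose_zero_right] at c2 c3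
    push_cast at c2 c3
    rw [heval]
    interval_cases w
    · rw [h0]; norm_num
    · rw [h1]; norm_num
    · rw [h2, show (n.choose 2 : ℚ) = n * (n - 1) / 2 by linarith]
      field_simp; norm_num
    · rw [show (n.choose 3 : ℚ) = n * (n - 1) * (n - 2) / 6 by linarith]
      field_simp; norm_num; ring

end WeightEnumerator

/-! ### The twisted cubic, its planes, and syndromes. -/

section Geometry

variable {F : Type*} [Field F]

/-- Normalised homogeneous coordinates on the projective line. -/
def lineCoord (t : OnePoint F) : F × F := t.elim (0, 1) (fun a => (1, a))

/-- The determinant of the normalised coordinates of two points of the projective line. -/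
def bracket (t x : OnePoint F) : F :=
  (lineCoord t).1 * (lineCoord x).2 - (lineCoord t).2 * (lineCoord x).1

@[simp] theorem lineCoord_infty : lineCoord (OnePoint.infty : OnePoint F) = (0, 1) := rfl

@[simp] theorem lineCoord_coe (a : F) : lineCoord (a : OnePoint F) = (1, a) := rfl

@[simp] theorem bracket_eq_zero {t x : OnePoint F} : bracket t x = 0 ↔ t = x := by
  induction t using OnePoint.rec <;> induction x using OnePoint.rec <;>
    simp [bracket, sub_eq_zero, eq_comm]

@[simp] theorem bracket_self (t : OnePoint F) : bracket t t = 0 := bracket_eq_zero.2 rfl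

theorem cubicPoint_eq (t : OnePoint F) : cubicPoint t =
    ![(lineCoord t).1 ^ 3, (lineCoord t).1 ^ 2 * (lineCoord t).2,
      (lineCoord t).1 * (lineCoord t).2 ^ 2, (lineCoord t).2 ^ 3] := by
  induction t using OnePoint.rec with
  | infty => simp [cubicPoint]
  | coe a => simp [cubicPoint]

/-- The equation of the plane which meets the twisted cubic in `P(x)`, `P(y)`, `P(z)`. -/
def planeForm (x y z : OnePoint F) (s : Fin 4 → F) : F :=
  (lineCoord x).2 * (lineCoord y).2 * (lineCoord z).2 * s 0
    - ((lineCoord x).1 * (lineCoord y).2 * (lineCoord z).2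
      + (lineCoord x).2 * (lineCoord y).1 * (lineCoord z).2
      + (lineCoord x).2 * (lineCoord y).2 * (lineCoord z).1) * s 1
    + ((lineCoord x).1 * (lineCoord y).1 * (lineCoord z).2
      + (lineCoord x).1 * (lineCoord y).2 * (lineCoord z).1
      + (lineCoord x).2 * (lineCoord y).1 * (lineCoord z).1) * s 2
    - (lineCoord x).1 * (lineCoord y).1 * (lineCoord z).1 * s 3

/-- The coefficients are those of the binary cubic with roots `x`, `y`, `z`, so on the curve the
form factors. -/
theorem planeForm_cubicPoint (x y z t : OnePoint F) :
    planeForm x y z (cubicPoint t) = bracket t x * bracket t y * bracket t z := by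
  simp [planeForm, cubicPoint_eq, bracket]
  ring

variable {n : ℕ} (e : Fin n ≃ OnePoint F) (v : Fin n → Fˣ)

theorem planeForm_mulVec (x y z : OnePoint F) (u : Fin n → F) :
    planeForm x y z (Matrix.mulVec (parityCheck e v) u) =
      ∑ k, u k * v k * (bracket (e k) x * bracket (e k) y * bracket (e k) z) := by
  simp only [← planeForm_cubicPoint]
  simp only [planeForm, Matrix.mulVec, dotProduct, parityCheck, Matrix.of_apply, mul_sum,
    ← sum_sub_distrib, ← sum_add_distrib]
  exact sum_congr rfl fun k _ => by ring

variable {e v}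

/-- Any four columns of the parity check matrix are linearly independent. -/
theorem eq_zero_of_mulVec_eq_zero {T : Finset (Fin n)} (hT : T.card = 4) {u : Fin n → F}
    (hu : ∀ k ∉ T, u k = 0) (h : Matrix.mulVec (parityCheck e v) u = 0) : u = 0 := by
  classical
  funext k
  by_cases hk : k ∈ T
  · have hc : (T.erase k).card = 3 := by rw [card_erase_of_mem hk, hT]
    obtain ⟨a, b, c, -, -, -, habc⟩ := card_eq_three.1 hc
    have hform := planeForm_mulVec e v (e a) (e b) (e c) u
    have hkT : k ∉ ({a, b, c} : Finset (Fin n)) := habc ▸ notMem_erase k T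
    simp only [mem_insert, mem_singleton, not_or] at hkT
    rw [h, sum_eq_single k] at hform
    · simpa [planeForm, hkT] using hform.symm
    · intro l _ hl
      by_cases hlT : l ∈ T
      · have hl' : l ∈ ({a, b, c} : Finset (Fin n)) := habc ▸ mem_erase.2 ⟨hl, hlT⟩
        simp only [mem_insert, mem_singleton] at hl'
        rcases hl' with rfl | rfl | rfl <;> simp
      · simp [hu l hlT]
    · simp
  · exact hu k hk

/-- Any four columns of the parity check matrix span `F ^ 4`. -/
theorem exists_mulVec_eq {T : Finset (Fin n)} (hT : T.card = 4) (s : Fin 4 → F) :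
    ∃ u : Fin n → F, (∀ k ∉ T, u k = 0) ∧ Matrix.mulVec (parityCheck e v) u = s := by
  classical
  let f : (T → F) →ₗ[F] (Fin 4 → F) :=
    (parityCheck e v).mulVecLin ∘ₗ Function.ExtendByZero.linearMap F (Subtype.val : T → Fin n)
  have hout : ∀ (y : T → F), ∀ k ∉ T,
      Function.ExtendByZero.linearMap F (Subtype.val : T → Fin n) y k = 0 := by
    intro y k hk
    rw [Function.ExtendByZero.linearMap_apply, Function.extend_apply' _ _ _ (by simpa using hk)]
    rfl
  have hinj : Function.Injective f := by
    rw [injective_iff_map_eq_zero]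
    intro y hy
    have h0 := eq_zero_of_mulVec_eq_zero hT (hout y) hy
    funext k
    have := congrFun h0 k
    rwa [Function.ExtendByZero.linearMap_apply, Subtype.val_injective.extend_apply] at this
  have hsurj : Function.Surjective f :=
    (LinearMap.injective_iff_surjective_of_finrank_eq_finrank (by simp [hT])).1 hinj
  obtain ⟨y, hy⟩ := hsurj s
  exact ⟨_, hout y, hy⟩

theorem mem_code_iff {u : Fin n → F} :
    u ∈ code e v ↔ Matrix.mulVec (parityCheck e v) u = 0 := by
  rw [code, LinearMap.mem_ker, Matrix.mulVecLin_apply]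

theorem isCoset_code_iff {V : Set (Fin n → F)} : IsCoset (code e v) V ↔
    ∃ u₀, V = {u | Matrix.mulVec (parityCheck e v) u = Matrix.mulVec (parityCheck e v) u₀} := by
  refine exists_congr fun u₀ => ?_
  have : {x | ∃ c ∈ code e v, x = c + u₀} =
      {u | Matrix.mulVec (parityCheck e v) u = Matrix.mulVec (parityCheck e v) u₀} := by
    ext u
    simp only [Set.mem_ofPred_eq]
    constructor
    · rintro ⟨c, hc, rfl⟩
      rw [Matrix.mulVec_add, mem_code_iff.1 hc, zero_add]
    · intro h
      exact ⟨u - u₀, mem_code_iff.2 (by rw [Matrix.mulVec_sub, h, sub_self]), by simp⟩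
  rw [this]

/-- On a set of at least four positions, a coset has as many vectors as the code. -/
theorem ncard_supported_eq {T : Finset (Fin n)} (hT : 4 ≤ T.card) (s : Fin 4 → F) :
    {u | Matrix.mulVec (parityCheck e v) u = s ∧ ∀ k ∉ T, u k = 0}.ncard =
      {u | u ∈ (code e v : Set (Fin n → F)) ∧ ∀ k ∉ T, u k = 0}.ncard := by
  obtain ⟨T', hsub, hT'⟩ := exists_subset_card_eq hT
  obtain ⟨u₀, hu₀, hs⟩ := exists_mulVec_eq (e := e) (v := v) hT' s
  have hu₀T : ∀ k ∉ T, u₀ k = 0 := fun k hk => hu₀ k fun h => hk (hsub h)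
  -- Translation by `u₀`, which has syndrome `s` and support in `T`, gives the bijection.
  rw [← Set.ncard_image_of_injective _ (sub_left_injective (b := u₀))]
  congr 1
  ext u
  simp only [Set.mem_image, Set.mem_ofPred_eq, SetLike.mem_coe, mem_code_iff]
  constructor
  · rintro ⟨w, ⟨hw, hwT⟩, rfl⟩
    exact ⟨by rw [Matrix.mulVec_sub, hw, hs, sub_self],
      fun k hk => by simp [hwT k hk, hu₀T k hk]⟩
  · rintro ⟨hu, huT⟩
    exact ⟨u + u₀, ⟨by rw [Matrix.mulVec_add, hu, hs, zero_add],
      fun k hk => by simp [huT k hk, hu₀T k hk]⟩, by simp⟩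

variable [DecidableEq F]

/-- Two vectors with the same syndrome whose supports have at most four positions in total are
equal. -/
theorem eq_of_mulVec_eq (hn : 4 ≤ n) {u w : Fin n → F}
    (hcard : ((univ.filter fun k => u k ≠ 0) ∪ univ.filter fun k => w k ≠ 0).card ≤ 4)
    (h : Matrix.mulVec (parityCheck e v) u = Matrix.mulVec (parityCheck e v) w) : u = w := by
  obtain ⟨T, hsub, hT⟩ := exists_superset_card_eq hcard (by simpa using hn)
  refine sub_eq_zero.1 (eq_zero_of_mulVec_eq_zero (e := e) (v := v) hT (fun k hk => ?_)
    (by rw [Matrix.mulVec_sub, h, sub_self]))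
  have hk' : k ∉ _ := fun h => hk (hsub h)
  simp only [mem_union, mem_filter, mem_univ, true_and, not_or, not_not] at hk'
  simp [hk'.1, hk'.2]

theorem eq_of_mulVec_eq_of_hammingNorm_le (hn : 4 ≤ n) {u w : Fin n → F}
    (hw : hammingNorm u + hammingNorm w ≤ 4)
    (h : Matrix.mulVec (parityCheck e v) u = Matrix.mulVec (parityCheck e v) w) : u = w :=
  eq_of_mulVec_eq hn ((card_union_le _ _).trans hw) h

end Geometry

/-! ### Vectors of weight three in a coset of weight two. -/

section WeightThree

variable {F : Type*} [Field F]

/-- The Plücker relation; it makes the ratio of brackets an injective coordinate. -/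
theorem bracket_mul_sub_mul (i j x y : OnePoint F) :
    bracket i x * bracket j y - bracket i y * bracket j x = bracket i j * bracket x y := by
  simp only [bracket]
  ring

variable {n : ℕ} {e : Fin n ≃ OnePoint F} {v : Fin n → Fˣ}

/-- Three columns span a syndrome iff the plane through them contains it. -/
theorem exists_supported_iff_planeForm_eq_zero {i a b c : Fin n} (hab : a ≠ b) (hac : a ≠ c)
    (hbc : b ≠ c) (ha : i ≠ a) (hb : i ≠ b) (hc : i ≠ c) (s : Fin 4 → F) :
    (∃ u : Fin n → F, (∀ k ∉ ({a, b, c} : Finset (Fin n)), u k = 0) ∧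
        Matrix.mulVec (parityCheck e v) u = s) ↔ planeForm (e a) (e b) (e c) s = 0 := by
  constructor
  · rintro ⟨u, hu, rfl⟩
    rw [planeForm_mulVec]
    refine sum_eq_zero fun k _ => ?_
    by_cases hk : k ∈ ({a, b, c} : Finset (Fin n))
    · simp only [mem_insert, mem_singleton] at hk
      rcases hk with rfl | rfl | rfl <;> simp
    · simp [hu k hk]
  · intro h
    -- The auxiliary column `i` completes a basis; lying in the plane forces its coefficient to
    -- vanish.
    have hT : ({i, a, b, c} : Finset (Fin n)).card = 4 := by
      rw [card_insert_of_notMem (by simp [ha, hb, hc]),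
        card_eq_three.2 ⟨a, b, c, hab, hac, hbc, rfl⟩]
    obtain ⟨u, hu, rfl⟩ := exists_mulVec_eq (e := e) (v := v) hT s
    have hui : u i = 0 := by
      rw [planeForm_mulVec, sum_eq_single i] at h
      · simpa [ha, hb, hc] using h
      · intro k _ hk
        by_cases hkT : k ∈ ({i, a, b, c} : Finset (Fin n))
        · simp only [mem_insert, mem_singleton] at hkT
          rcases hkT with rfl | rfl | rfl | rfl
          · exact absurd rfl hk
          all_goals simp
        · simp [hu k hkT]
      · simp
    refine ⟨u, fun k hk => ?_, rfl⟩
    by_cases hki : k = i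
    · rw [hki, hui]
    · exact hu k (by simp only [mem_insert, hki, false_or]; simpa using hk)

variable [Fintype F] [DecidableEq F]

/-- The points other than `e i` and `e j` are parametrised by the units of `F`, through the
ratio of their brackets with `e i` and `e j`. -/
theorem exists_units_parametrisation (hn : n = Fintype.card F + 1) (e : Fin n ≃ OnePoint F)
    {i j : Fin n} (hij : i ≠ j) :
    ∃ g : Fˣ ↪ Fin n, (∀ k, k ∈ univ.map g ↔ k ≠ i ∧ k ≠ j) ∧
      ∀ x, bracket (e i) (e (g x)) = x * bracket (e j) (e (g x)) := by
  have hne : ∀ {k l : Fin n}, k ≠ l → bracket (e k) (e l) ≠ 0 := by simp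
  let ρ : {k : Fin n // k ≠ i ∧ k ≠ j} → Fˣ := fun k =>
    Units.mk0 (bracket (e i) (e k) / bracket (e j) (e k))
      (div_ne_zero (hne k.2.1.symm) (hne k.2.2.symm))
  have hinj : Function.Injective ρ := by
    intro k l hkl
    have h := congrArg Units.val hkl
    simp only [ρ, Units.val_mk0] at h
    rw [div_eq_div_iff (hne k.2.2.symm) (hne l.2.2.symm)] at h
    have h2 := bracket_mul_sub_mul (e i) (e j) (e k) (e l)
    rw [h, sub_self, eq_comm, mul_eq_zero, or_iff_right (hne hij), bracket_eq_zero] at h2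
    exact Subtype.ext (e.injective h2)
  -- Both sides have `q - 1` elements, so injectivity suffices.
  have hcard : Fintype.card {k : Fin n // k ≠ i ∧ k ≠ j} = Fintype.card Fˣ := by
    have : (univ.filter fun k : Fin n => k ≠ i ∧ k ≠ j) = (univ.erase j).erase i := by
      ext k
      simp
    rw [Fintype.card_subtype, this, card_erase_of_mem (by simp [hij]),
      card_erase_of_mem (mem_univ _), card_univ, Fintype.card_fin, hn, Fintype.card_units]
    simp
  have hbij : Function.Bijective ρ := (Fintype.bijective_iff_injective_and_card ρ).2 ⟨hinj, hcard⟩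
  let σ := Equiv.ofBijective ρ hbij
  refine ⟨σ.symm.toEmbedding.trans (Function.Embedding.subtype _), fun k => ?_, fun x => ?_⟩
  · rw [mem_map]
    constructor
    · rintro ⟨x, -, rfl⟩
      exact (σ.symm x).2
    · intro hk
      exact ⟨σ ⟨k, hk⟩, mem_univ _, by simp⟩
  · have h := congrArg Units.val (σ.apply_symm_apply x)
    have h' : bracket (e i) (e (σ.symm x)) / bracket (e j) (e (σ.symm x)) = (x : F) := h
    rwa [div_eq_iff (hne (σ.symm x).2.2.symm)] at h'

/-- The vectors of weight three in a coset of weight two correspond to the three-element sets of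
units with a given product. -/
theorem exists_weightCount_three_eq (hn : n = Fintype.card F + 1) (hn4 : 4 ≤ n)
    {u₀ : Fin n → F} (hu₀ : hammingNorm u₀ = 2) :
    ∃ c : Fˣ, weightCount
        {u | Matrix.mulVec (parityCheck e v) u = Matrix.mulVec (parityCheck e v) u₀} 3 =
      ((univ.powersetCard 3).filter fun S : Finset Fˣ => ∏ x ∈ S, x = c).card := by
  obtain ⟨i, j, hij, hsupp⟩ :=
    card_eq_two.1 (show (univ.filter fun k => u₀ k ≠ 0).card = 2 from hu₀)
  have hmem : ∀ k, u₀ k ≠ 0 ↔ k = i ∨ k = j := by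
    intro k
    have := congrArg (k ∈ ·) hsupp
    simpa using this
  have hi : u₀ i ≠ 0 := (hmem i).2 (Or.inl rfl)
  have hj : u₀ j ≠ 0 := (hmem j).2 (Or.inr rfl)
  obtain ⟨g, hg, hρ⟩ := exists_units_parametrisation hn e hij
  have hgi : ∀ x, g x ≠ i ∧ g x ≠ j := fun x => (hg _).1 (mem_map_of_mem g (mem_univ x))
  -- Up to a nonzero factor the plane form of the syndrome is `x * y * z * (u₀ i * v i) + u₀ j * v
  -- j`, whence `c`.
  let c : Fˣ := -(Units.mk0 _ hj * v j) / (Units.mk0 _ hi * v i)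
  have hspan : ∀ {x y z : Fˣ}, x ≠ y → x ≠ z → y ≠ z →
      ((∃ u : Fin n → F, (∀ k ∉ ({g x, g y, g z} : Finset (Fin n)), u k = 0) ∧
        Matrix.mulVec (parityCheck e v) u = Matrix.mulVec (parityCheck e v) u₀) ↔
          x * y * z = c) := by
    intro x y z hxy hxz hyz
    rw [exists_supported_iff_planeForm_eq_zero (g.injective.ne hxy) (g.injective.ne hxz)
      (g.injective.ne hyz) (hgi x).1.symm (hgi y).1.symm (hgi z).1.symm, planeForm_mulVec,
      ← sum_subset (subset_univ {i, j}), sum_pair hij, hρ, hρ, hρ]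
    · have hb : ∀ t, bracket (e j) (e (g t)) ≠ 0 := by
        intro t
        simpa using (hgi t).2.symm
      have hfactor : u₀ i * v i * (x * bracket (e j) (e (g x)) * (y * bracket (e j) (e (g y))) *
            (z * bracket (e j) (e (g z)))) + u₀ j * v j * (bracket (e j) (e (g x)) *
            bracket (e j) (e (g y)) * bracket (e j) (e (g z))) =
          (x * y * z * (u₀ i * v i) + u₀ j * v j) * (bracket (e j) (e (g x)) *
            bracket (e j) (e (g y)) * bracket (e j) (e (g z))) := by ring
      rw [hfactor, mul_eq_zero, or_iff_left (mul_ne_zero (mul_ne_zero (hb x) (hb y)) (hb z)),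
        add_eq_zero_iff_eq_neg, eq_div_iff_mul_eq', Units.ext_iff]
      simp [mul_comm, mul_left_comm]
    · intro k _ hk
      have : u₀ k = 0 := by
        by_contra h
        exact hk (by simpa using (hmem k).1 h)
      simp [this]
  refine ⟨c, ?_⟩
  let supp : (Fin n → F) → Finset (Fin n) := fun u => univ.filter fun k => u k ≠ 0
  have hsinj : Set.InjOn supp {u | u ∈ {u | Matrix.mulVec (parityCheck e v) u =
      Matrix.mulVec (parityCheck e v) u₀} ∧ hammingNorm u = 3} := by
    rintro u ⟨hu, hu3⟩ w ⟨hw, -⟩ huw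
    refine eq_of_mulVec_eq (e := e) (v := v) hn4 ?_ (hu.trans hw.symm)
    change (supp u ∪ supp w).card ≤ 4
    rw [← huw, union_self]
    exact le_trans hu3.le (by norm_num)
  rw [weightCount, ← hsinj.ncard_image, ← Set.ncard_coe_finset,
    ← Set.ncard_image_of_injective _ (map_injective g)]
  congr 1
  ext T
  simp only [Set.mem_image, Set.mem_ofPred_eq, mem_coe, mem_filter, mem_powersetCard_univ]
  constructor
  · rintro ⟨u, ⟨hu, hu3⟩, rfl⟩
    have hne : u ≠ u₀ := by
      rintro rfl
      omega
    -- If the supports met, their union would have at most four positions, forcing `u = u₀`.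
    have hdisj : ∀ l, l = i ∨ l = j → l ∉ supp u := by
      intro l hl hlu
      refine hne (eq_of_mulVec_eq (e := e) (v := v) hn4 ?_ hu)
      change (supp u ∪ supp u₀).card ≤ 4
      have h1 := card_union_add_card_inter (supp u) (supp u₀)
      have h2 : 0 < (supp u ∩ supp u₀).card :=
        card_pos.2 ⟨l, mem_inter.2 ⟨hlu, mem_filter.2 ⟨mem_univ _, (hmem l).2 hl⟩⟩⟩
      have h3 : (supp u).card = 3 := hu3
      have h4 : (supp u₀).card = 2 := hu₀
      omega
    have hsub : supp u ⊆ univ.map g := fun k hk =>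
      (hg k).2 ⟨fun h => hdisj k (Or.inl h) hk, fun h => hdisj k (Or.inr h) hk⟩
    obtain ⟨S, -, hS⟩ := subset_map_iff.1 hsub
    have hS3 : S.card = 3 := by
      rw [← card_map g, ← hS]
      exact hu3
    obtain ⟨x, y, z, hxy, hxz, hyz, rfl⟩ := card_eq_three.1 hS3
    refine ⟨{x, y, z}, ⟨hS3, ?_⟩, hS.symm⟩
    rw [prod_insert (by simp [hxy, hxz]), prod_insert (by simp [hyz]), prod_singleton, ← mul_assoc,
      ← hspan hxy hxz hyz]
    refine ⟨u, fun k hk => ?_, hu⟩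
    by_contra h
    have : k ∈ supp u := mem_filter.2 ⟨mem_univ _, h⟩
    rw [hS] at this
    exact hk (by simpa using this)
  · rintro ⟨S, ⟨hS3, hprod⟩, rfl⟩
    obtain ⟨x, y, z, hxy, hxz, hyz, rfl⟩ := card_eq_three.1 hS3
    rw [prod_insert (by simp [hxy, hxz]), prod_insert (by simp [hyz]), prod_singleton, ← mul_assoc,
      ← hspan hxy hxz hyz] at hprod
    obtain ⟨u, hu, hus⟩ := hprod
    have hsub : supp u ⊆ ({x, y, z} : Finset Fˣ).map g := by
      intro k hk
      by_contra h
      exact (mem_filter.1 hk).2 (hu k (by simpa using h))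
    -- A vector of weight at most 2 with this syndrome equals `u₀`, yet `u` vanishes at `i`.
    have hcard : 3 ≤ (supp u).card := by
      by_contra h
      have heq : u = u₀ := by
        refine eq_of_mulVec_eq_of_hammingNorm_le (e := e) (v := v) hn4 ?_ hus
        have : hammingNorm u = (supp u).card := rfl
        omega
      refine hi (heq ▸ hu i ?_)
      simp [(hgi x).1.symm, (hgi y).1.symm, (hgi z).1.symm]
    have hsupp_eq : supp u = ({x, y, z} : Finset Fˣ).map g :=
      eq_of_subset_of_card_le hsub (by rw [card_map, hS3]; exact hcard)
    exact ⟨u, ⟨hus, by rw [← hS3, ← card_map g, ← hsupp_eq]; rfl⟩, hsupp_eq⟩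

end WeightThree

end TwistedCubicCode

/-! ### Assembly of the weight distribution. -/

theorem theorem4p3 {F : Type*} [Field F] [Fintype F] [DecidableEq F] (q : ℕ)
    (hq : Fintype.card F = q) (hq5 : 5 ≤ q)
    (e : Fin (q + 1) ≃ OnePoint F) (v : Fin (q + 1) → Fˣ)
    (C : Submodule F (Fin (q + 1) → F)) (hC : C = TwistedCubicCode.code e v)
    (V : Set (Fin (q + 1) → F)) (hV : TwistedCubicCode.IsCoset C V)
    (hV2 : TwistedCubicCode.HasWeight V 2)
    (A B : ℕ → ℕ)
    (hA : A = TwistedCubicCode.weightCount (C : Set (Fin (q + 1) → F)))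
    (hB : B = TwistedCubicCode.weightCount V) :
    B 0 = 0 ∧ B 1 = 0 ∧ B 2 = 1 ∧
    (¬ q ≡ 1 [MOD 3] → (B 3 : ℚ) = 1 / 3 * ((q - 2).choose 2 : ℚ)) ∧
    (q ≡ 1 [MOD 3] →
      (B 3 : ℚ) ∈ ({((q : ℚ) ^ 2 - 5 * q + 4) / 6, ((q : ℚ) ^ 2 - 5 * q + 10) / 6} : Set ℚ)) ∧
    (B 4 : ℚ) = ((q + 1).choose 4 : ℚ) - ((q - 1).choose 2 : ℚ) - ((q : ℚ) - 2) * (B 3 : ℚ) ∧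
    ∀ w : ℕ, 5 ≤ w →
      (B w : ℚ) = (A w : ℚ) + (-1) ^ w *
        (((q + 1).choose w : ℚ) * ((w - 1).choose 3 : ℚ)
          - ((w : ℚ) - 3) * ((q - 1).choose (w - 2) : ℚ)
          - ((q - 2).choose (w - 3) : ℚ) * (B 3 : ℚ)) := by
  classical
  subst hC
  obtain ⟨⟨u₀, hu₀V, hu₀⟩, hmin⟩ := hV2
  obtain ⟨u₁, hV⟩ := TwistedCubicCode.isCoset_code_iff.1 hV
  have hs : Matrix.mulVec (TwistedCubicCode.parityCheck e v) u₀ =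
      Matrix.mulVec (TwistedCubicCode.parityCheck e v) u₁ := by
    rw [hV] at hu₀V
    exact hu₀V
  -- The weight-two vector `u₀` now represents the coset.
  rw [← hs] at hV
  have hB_zero : ∀ w < 2, B w = 0 := by
    intro w hw
    rw [hB, TwistedCubicCode.weightCount, Set.ncard_eq_zero, Set.eq_empty_iff_forall_notMem]
    rintro x ⟨hx, rfl⟩
    exact absurd (hmin ⟨x, hx, rfl⟩) (by omega)
  have hB_two : B 2 = 1 := by
    rw [hB, TwistedCubicCode.weightCount, Set.ncard_eq_one]
    refine ⟨u₀, Set.eq_singleton_iff_unique_mem.2 ⟨⟨hu₀V, hu₀⟩, ?_⟩⟩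
    rintro x ⟨hx, hx2⟩
    rw [hV] at hx
    exact TwistedCubicCode.eq_of_mulVec_eq_of_hammingNorm_le (by omega) (by omega) hx
  have hA_zero : A 0 = 1 := by
    rw [hA, TwistedCubicCode.weightCount, Set.ncard_eq_one]
    refine ⟨0, Set.eq_singleton_iff_unique_mem.2 ⟨⟨zero_mem _, hammingNorm_zero⟩, ?_⟩⟩
    rintro x ⟨-, hx⟩
    exact hammingNorm_eq_zero.1 hx
  have hA_low : ∀ w, 1 ≤ w → w ≤ 4 → A w = 0 := by
    intro w hw1 hw4
    rw [hA, TwistedCubicCode.weightCount, Set.ncard_eq_zero, Set.eq_empty_iff_forall_notMem]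
    rintro x ⟨hx, rfl⟩
    have : x = 0 := by
      refine TwistedCubicCode.eq_of_mulVec_eq_of_hammingNorm_le (e := e) (v := v) (by omega)
        (by simpa using hw4) ?_
      rw [Matrix.mulVec_zero]
      exact TwistedCubicCode.mem_code_iff.1 hx
    rw [this, hammingNorm_zero] at hw1
    omega
  have hmoments : ∀ j, 4 ≤ j → ∑ i ∈ Finset.range (j + 1),
      ((B i : ℚ) - A i) * ((q + 1 - i).choose (j - i) : ℚ) = 0 := by
    intro j hj
    have h : ∑ i ∈ Finset.range (j + 1), B i * (q + 1 - i).choose (j - i) =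
        ∑ i ∈ Finset.range (j + 1), A i * (q + 1 - i).choose (j - i) := by
      rw [hA, hB, TwistedCubicCode.sum_weightCount_mul_choose,
        TwistedCubicCode.sum_weightCount_mul_choose]
      refine Finset.sum_congr rfl fun T hT => ?_
      rw [Finset.mem_powersetCard_univ] at hT
      rw [hV]
      exact TwistedCubicCode.ncard_supported_eq (by omega) _
    have h' := congrArg (Nat.cast : ℕ → ℚ) h
    push_cast at h'
    simp only [sub_mul, Finset.sum_sub_distrib]
    rw [h', sub_self]
  -- Starting at 4 also covers `B 4`, since `A 4 = 0`.
  have hdiff : ∀ w : ℕ, 4 ≤ w → (B w : ℚ) - A w = (-1) ^ w *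
      (((q + 1).choose w : ℚ) * ((w - 1).choose 3 : ℚ)
        - ((w : ℚ) - 3) * ((q - 1).choose (w - 2) : ℚ)
        - ((q - 2).choose (w - 3) : ℚ) * (B 3 : ℚ)) := by
    intro w hw
    have h := TwistedCubicCode.weight_difference_eq (n := q + 1) (D := fun i => (B i : ℚ) - A i)
      (by omega) (by simp [hB_zero 0, hA_zero]) (by simp [hB_zero 1, hA_low 1])
      (by simp [hB_two, hA_low 2]) hmoments (w := w) (by omega)
    simpa [hA_low 3, show q + 1 - 2 = q - 1 by omega, show q + 1 - 3 = q - 2 by omega] using h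
  obtain ⟨c, hc⟩ := TwistedCubicCode.exists_weightCount_three_eq (e := e) (v := v)
    (by rw [hq]) (by omega) hu₀
  rw [← hV, ← congrFun hB 3] at hc
  have hunits : (Fintype.card Fˣ : ℤ) = q - 1 := by
    rw [Fintype.card_units, hq, Nat.cast_sub (by omega)]
    simp
  have hB_three := TwistedCubicCode.six_mul_card_triples_prod_eq c
  rw [← hc, hunits] at hB_three
  have hgcd : Nat.card Fˣ = q - 1 := by rw [Nat.card_eq_fintype_card, Fintype.card_units, hq]
  refine ⟨hB_zero 0 (by norm_num), hB_zero 1 (by norm_num), hB_two, fun hq3 => ?_, fun hq3 => ?_,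
    ?_, fun w hw => ?_⟩
  · have hcop : (Nat.card Fˣ).Coprime 3 := by
      rw [hgcd, Nat.coprime_comm, Nat.Prime.coprime_iff_not_dvd Nat.prime_three]
      intro h
      exact hq3 ((Nat.modEq_iff_dvd' (by omega)).2 h).symm
    rw [TwistedCubicCode.card_cube_roots_of_coprime hcop] at hB_three
    have hB_three' : (6 : ℚ) * B 3 = (q - 1) ^ 2 - 3 * (q - 1) + 2 * 1 := by
      exact_mod_cast hB_three
    rw [Nat.cast_choose_two, Nat.cast_sub (by omega)]
    push_cast
    linarith
  · have hdvd : 3 ∣ q - 1 := (Nat.modEq_iff_dvd' (by omega)).1 hq3.symm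
    rcases TwistedCubicCode.card_cube_roots c with h | h
    · left
      rw [h] at hB_three
      have hB_three' : (6 : ℚ) * B 3 = (q - 1) ^ 2 - 3 * (q - 1) + 2 * 0 := by
        exact_mod_cast hB_three
      linarith
    · right
      rw [h, ← Nat.card_eq_fintype_card, hgcd, Nat.gcd_eq_right hdvd] at hB_three
      have hB_three' : (6 : ℚ) * B 3 = (q - 1) ^ 2 - 3 * (q - 1) + 2 * 3 := by
        exact_mod_cast hB_three
      rw [Set.mem_singleton_iff]
      linarith
  · have h := hdiff 4 le_rfl
    rw [hA_low 4 (by norm_num) le_rfl] at h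
    norm_num at h
    rw [h, Nat.cast_sub (by omega)]
    push_cast
    ring
  · rw [← hdiff w (by omega)]
    ring
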